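/- Let $G$ be a finite connected undirected loopless multigraph with vertices $v_0,\dots,v_n$ ($n\ge 0$) and adjacency matrix $A$, let $R=(r_0,\dots,r_n)$ be a vector of positive integers with $\gcd(r_0,\dots,r_n)=1$, and let $\delta_0,\dots,\delta_n$ be non-negative integers with $QR=0$, where $Q=\mathrm{diag}(\delta_0,\dots,\delta_n)-A$; that is, $(G,R)$ is an arithmetical graph. Let $\Lambda\subseteq\mathbb Z^{n+1}$ be the lattice spanned by the columns of $Q$, and let $g_0$ be the integer with $2g_0-2=\sum_{i=0}^n r_i(\delta_i-2)$. For $D\in\mathbb Z^{n+1}$ put $\deg_R(D)=\sum_i r_iD_i$ and $$r(D)=\min\{\deg_R(E) : E\in\mathbb Z^{n+1},\ E\ge 0,\ \text{no } F\ge 0 \text{ satisfies } F-(D-E)\in\Lambda\}-1 .$$ Let $\Sigma=\{D\in\mathbb Z^{n+1} : D\not\ge p \text{ for all } p\in\Lambda\}$, and let $\mathrm{Ext}(\Sigma)$ be the set of $\nu\in\Sigma$ such that $\deg_R(\nu)\ge\deg_R(p)$ for all $p\in\Sigma$ with $\sum_i|p_i-\nu_i|\le 1$. Put $g_{\min}=\min\{\deg_R(\nu):\nu\in\mathrm{Ext}(\Sigma)\}+1$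 and $g_{\max}=\max\{\deg_R(\nu):\nu\in\mathrm{Ext}(\Sigma)\}+1$. We say that $(G,R)$ has the *Riemann–Roch property* if $\Lambda$ is a sublattice of rank $n$ of $\{D\in\mathbb Z^{n+1}:\deg_R(D)=0\}$, $g_{\min}$ and $g_{\max}$ exist and are equal, and, writing $g$ for their common value, there is $K\in\mathbb Z^{n+1}$ with $\deg_R(K)=2g-2$ such that $$r(D)-r(K-D)=\deg_R(D)-g+1\qquad\text{for all } D\in\mathbb Z^{n+1}.$$ **Theorem.** If $g_0\le 1$, then $(G,R)$ has the Riemann–Roch property. In particular, $(G,R)$ has the Riemann–Roch property if $\delta_i=2$ for all $i$, and also if every vertex of $G$ has degree $2$ (edges counted with multiplicity). -/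

import Mathlib

namespace RiemannRoch

/-! ### Riemann–Roch theory of a lattice orthogonal to a positive integer vector

Divisors are elements of `V → ℤ`, where `V` is the finite set of coordinates, with the coordinatewise
order; `R : V → ℕ` is the vector of weights. -/

/-- The degree `deg_R(D) = D · R` of a divisor. -/
def deg {V : Type*} [Fintype V] (R : V → ℕ) (D : V → ℤ) : ℤ := ∑ v, (R v : ℤ) * D v

/-- The lattice `Λ_R` of all integer vectors orthogonal to `R`. -/
def orthogonalLattice {V : Type*} [Fintype V] (R : V → ℕ) : Submodule ℤ (V → ℤ) where
  carrier := {D | deg R D = 0}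
  add_mem' := by
    intro a b ha hb
    simp only [Set.mem_ofPred_eq, deg, Pi.add_apply, mul_add, Finset.sum_add_distrib] at *
    rw [ha, hb, add_zero]
  zero_mem' := by simp [deg]
  smul_mem' := by
    intro c a ha
    simp only [Set.mem_ofPred_eq, deg, Pi.smul_apply, smul_eq_mul] at *
    have h : ∀ v, (R v : ℤ) * (c * a v) = c * ((R v : ℤ) * a v) := fun v => by ring
    simp only [h, ← Finset.mul_sum, ha, mul_zero]

/-- `Λ` is a full-dimensional sub-lattice of `Λ_R`: it is contained in `Λ_R` and its rank is one less
than the number of coordinates. -/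
def IsFullSublattice {V : Type*} [Fintype V] (R : V → ℕ) (Λ : Submodule ℤ (V → ℤ)) : Prop :=
  Λ ≤ orthogonalLattice R ∧ Module.finrank ℤ Λ + 1 = Fintype.card V

/-- The linear system `|D|`: all effective divisors `E` that are equivalent to `D` modulo `Λ`. -/
def linearSystem {V : Type*} (Λ : Submodule ℤ (V → ℤ)) (D : V → ℤ) : Set (V → ℤ) :=
  {E | 0 ≤ E ∧ E - D ∈ Λ}

/-- The set of degrees of effective divisors `E` with `|D - E| = ∅`. -/
def rankDegrees {V : Type*} [Fintype V] (R : V → ℕ) (Λ : Submodule ℤ (V → ℤ)) (D : V → ℤ) : Set ℤ :=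
  {d | ∃ E : V → ℤ, 0 ≤ E ∧ linearSystem Λ (D - E) = ∅ ∧ deg R E = d}

/-- The rank `r(D) = min {deg_R(E) : |D - E| = ∅, E ≥ 0} - 1`; the minimum is attained in the relevant
situation, see `isLeast_rank_add_one`. -/
noncomputable def rank {V : Type*} [Fintype V] (R : V → ℕ) (Λ : Submodule ℤ (V → ℤ)) (D : V → ℤ) : ℤ :=
  sInf (rankDegrees R Λ D) - 1

theorem deg_nonneg {V : Type*} [Fintype V] (R : V → ℕ) {E : V → ℤ} (hE : 0 ≤ E) : 0 ≤ deg R E :=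
  Finset.sum_nonneg fun v _ => mul_nonneg (Int.natCast_nonneg _) (hE v)

theorem deg_sub {V : Type*} [Fintype V] (R : V → ℕ) (D E : V → ℤ) :
    deg R (D - E) = deg R D - deg R E := by
  simp [deg, mul_sub, Finset.sum_sub_distrib]

/-- For a positive weight vector and a lattice inside `Λ_R`, the minimum in the definition of the rank
is attained. -/
theorem isLeast_rank_add_one {V : Type*} [Fintype V] [Nonempty V] (R : V → ℕ) (hR : ∀ v, 0 < R v)
    (Λ : Submodule ℤ (V → ℤ)) (hΛ : Λ ≤ orthogonalLattice R) (D : V → ℤ) :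
    IsLeast (rankDegrees R Λ D) (rank R Λ D + 1) := by
  have hbdd : BddBelow (rankDegrees R Λ D) := by
    refine ⟨0, ?_⟩
    rintro d ⟨E, hE, -, rfl⟩
    exact deg_nonneg R hE
  have hne : (rankDegrees R Λ D).Nonempty := by
    refine ⟨_, fun _ => |deg R D| + 1, fun v => ?_, ?_, rfl⟩
    · show (0 : ℤ) ≤ _
      positivity
    · rw [Set.eq_empty_iff_forall_notMem]
      rintro F ⟨hF, hFΛ⟩
      have h0 : deg R (F - (D - fun _ => |deg R D| + 1)) = 0 := hΛ hFΛ
      rw [deg_sub, deg_sub] at h0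
      have h1 := deg_nonneg R hF
      have h2 : |deg R D| + 1 ≤ deg R (fun _ : V => |deg R D| + 1) := by
        obtain ⟨w⟩ := ‹Nonempty V›
        have h3 : (R w : ℤ) * (|deg R D| + 1) ≤ deg R (fun _ : V => |deg R D| + 1) :=
          Finset.single_le_sum (f := fun v => (R v : ℤ) * (|deg R D| + 1))
            (fun v _ => by positivity) (Finset.mem_univ w)
        have h4 : (1 : ℤ) ≤ R w := by exact_mod_cast hR w
        nlinarith [abs_nonneg (deg R D)]
      have h5 := le_abs_self (deg R D)
      linarith
  have h : rank R Λ D + 1 = sInf (rankDegrees R Λ D) := by simp [rank]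
  rw [h]
  exact ⟨Int.csInf_mem hne hbdd, fun d hd => csInf_le hbdd hd⟩

/-- The region `Σ(Λ)`: the divisors that dominate no point of `Λ`. -/
def sigmaRegion {V : Type*} (Λ : Submodule ℤ (V → ℤ)) : Set (V → ℤ) :=
  {D | ∀ p ∈ Λ, ¬ p ≤ D}

/-- The extreme divisors `Ext(Σ(Λ))`: the points of `Σ(Λ)` whose degree is maximal among all points of
`Σ(Λ)` at `ℓ¹`-distance at most one. -/
def extremeDivisors {V : Type*} [Fintype V] (R : V → ℕ) (Λ : Submodule ℤ (V → ℤ)) : Set (V → ℤ) :=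
  {ν | ν ∈ sigmaRegion Λ ∧ ∀ p ∈ sigmaRegion Λ, ∑ v, |p v - ν v| ≤ 1 → deg R p ≤ deg R ν}

/-- `g = g_min`, i.e. `g = min {deg_R(ν) : ν ∈ Ext(Σ(Λ))} + 1`, the minimum being attained. -/
def IsGMin {V : Type*} [Fintype V] (R : V → ℕ) (Λ : Submodule ℤ (V → ℤ)) (g : ℤ) : Prop :=
  IsLeast (deg R '' extremeDivisors R Λ) (g - 1)

/-- `g = g_max`, i.e. `g = max {deg_R(ν) : ν ∈ Ext(Σ(Λ))} + 1`, the maximum being attained. -/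
def IsGMax {V : Type*} [Fintype V] (R : V → ℕ) (Λ : Submodule ℤ (V → ℤ)) (g : ℤ) : Prop :=
  IsGreatest (deg R '' extremeDivisors R Λ) (g - 1)

/-- The Riemann–Roch property: `Λ` is a full-dimensional sub-lattice of `Λ_R`, it is uniform (that is,
`g_min = g_max =: g`), and there is a divisor `K` of degree `2g - 2` such that
`r(D) - r(K - D) = deg_R(D) - g + 1` for all divisors `D`. -/
def HasRiemannRochProperty {V : Type*} [Fintype V] (R : V → ℕ) (Λ : Submodule ℤ (V → ℤ)) : Prop :=
  IsFullSublattice R Λ ∧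
    ∃ g : ℤ, IsGMin R Λ g ∧ IsGMax R Λ g ∧
      ∃ K : V → ℤ, deg R K = 2 * g - 2 ∧
        ∀ D : V → ℤ, rank R Λ D - rank R Λ (K - D) = deg R D - g + 1

/-! ### Arithmetical graphs -/

/-- An undirected loopless multigraph on the vertex set `V`; `mult u v` is the number of edges between
`u` and `v`. -/
structure Multigraph (V : Type*) where
  mult : V → V → ℕ
  symm : ∀ u v, mult u v = mult v u
  loopless : ∀ v, mult v v = 0

namespace Multigraph

/-- The simple graph in which two vertices are adjacent if some edge of the multigraph joins them. -/
def toSimpleGraph {V : Type*} (G : Multigraph V) : SimpleGraph V where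
  Adj u v := G.mult u v ≠ 0
  symm := ⟨fun u v h => by rwa [G.symm v u]⟩
  loopless := ⟨fun v h => h (G.loopless v)⟩

/-- The degree of a vertex, edges being counted with multiplicity. -/
def degree {V : Type*} [Fintype V] (G : Multigraph V) (v : V) : ℕ := ∑ u, G.mult v u

/-- The adjacency matrix. -/
def adjMatrix {V : Type*} (G : Multigraph V) : Matrix V V ℤ :=
  Matrix.of fun u v => (G.mult u v : ℤ)

end Multigraph

/-- An arithmetical graph `(G, R)`: a connected loopless multigraph with positive vertex
multiplicities `r v` whose greatest common divisor is `1`, and natural numbers `δ v` such that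
`(diag(δ) - A) R = 0`, where `A` is the adjacency matrix. -/
structure ArithmeticalGraph (V : Type*) [Fintype V] [DecidableEq V] extends Multigraph V where
  connected : toMultigraph.toSimpleGraph.Connected
  r : V → ℕ
  r_pos : ∀ v, 0 < r v
  gcd_r : Finset.univ.gcd r = 1
  δ : V → ℕ
  mulVec_r : (Matrix.diagonal (fun v => (δ v : ℤ)) - toMultigraph.adjMatrix).mulVec
    (fun v => (r v : ℤ)) = 0

namespace ArithmeticalGraph

/-- The Laplacian `Q = diag(δ) - A`. -/
def laplacian {V : Type*} [Fintype V] [DecidableEq V] (G : ArithmeticalGraph V) : Matrix V V ℤ :=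
  Matrix.diagonal (fun v => (G.δ v : ℤ)) - G.adjMatrix

/-- The lattice `Λ_(G,R)` spanned by the columns of the Laplacian. -/
def lattice {V : Type*} [Fintype V] [DecidableEq V] (G : ArithmeticalGraph V) :
    Submodule ℤ (V → ℤ) :=
  Submodule.span ℤ (Set.range G.laplacian.col)

/-- The integer `g₀` determined by `2 g₀ - 2 = ∑ r_i (δ_i - 2)`; see `two_mul_g0_sub_two`. -/
def g0 {V : Type*} [Fintype V] [DecidableEq V] (G : ArithmeticalGraph V) : ℤ :=
  (∑ v, (G.r v : ℤ) * ((G.δ v : ℤ) - 2)) / 2 + 1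

theorem delta_mul_r {V : Type*} [Fintype V] [DecidableEq V] (G : ArithmeticalGraph V) (v : V) :
    (G.δ v : ℤ) * G.r v = ∑ u, (G.mult v u : ℤ) * G.r u := by
  have h := congrFun G.mulVec_r v
  rw [Matrix.sub_mulVec, Pi.sub_apply, Matrix.mulVec_diagonal, Pi.zero_apply, sub_eq_zero] at h
  simpa [Matrix.mulVec, dotProduct, Multigraph.adjMatrix] using h

/-- A symmetric double sum over the integers with vanishing diagonal is even. -/
theorem even_sum_symm {V : Type*} [DecidableEq V] (f : V → V → ℤ) (hs : ∀ u v, f u v = f v u)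
    (h0 : ∀ v, f v v = 0) (s : Finset V) : Even (∑ v ∈ s, ∑ u ∈ s, f v u) := by
  induction s using Finset.induction_on with
  | empty => simp
  | insert a s ha ih =>
    rw [Finset.sum_insert ha, Finset.sum_insert ha, h0, zero_add]
    simp only [Finset.sum_insert ha, Finset.sum_add_distrib]
    have h : ∑ v ∈ s, f v a = ∑ v ∈ s, f a v := Finset.sum_congr rfl fun v _ => hs v a
    rw [h, ← add_assoc]
    exact (Even.add_self _).add ih

/-- The defining equation of `g₀`: the sum on the right is even. -/
theorem two_mul_g0_sub_two {V : Type*} [Fintype V] [DecidableEq V] (G : ArithmeticalGraph V) :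
    2 * G.g0 - 2 = ∑ v, (G.r v : ℤ) * ((G.δ v : ℤ) - 2) := by
  have h1 : Even (∑ v, ∑ u, (G.r v : ℤ) * ((G.mult v u : ℤ) * G.r u)) :=
    even_sum_symm _ (fun u v => by rw [G.symm u v]; ring) (fun v => by simp [G.loopless v]) _
  have h2 : ∑ v, ∑ u, (G.r v : ℤ) * ((G.mult v u : ℤ) * G.r u)
      = ∑ v, (G.r v : ℤ) * ((G.δ v : ℤ) * G.r v) :=
    Finset.sum_congr rfl fun v _ => by rw [delta_mul_r, Finset.mul_sum]
  rw [h2] at h1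
  have h3 : Even (∑ v, (G.r v : ℤ) * ((G.δ v : ℤ) * G.r v)
      - ∑ v, (G.r v : ℤ) * ((G.δ v : ℤ) - 2)) := by
    rw [← Finset.sum_sub_distrib]
    refine Finset.even_sum _ fun v _ => ?_
    have h4 : (G.r v : ℤ) * ((G.δ v : ℤ) * G.r v) - (G.r v : ℤ) * ((G.δ v : ℤ) - 2)
        = (G.δ v : ℤ) * ((G.r v : ℤ) * ((G.r v : ℤ) - 1)) + 2 * G.r v := by ring
    rw [h4]
    exact ((Int.even_mul_pred_self _).mul_left _).add (even_two_mul _)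
  have h5 : Even (∑ v, (G.r v : ℤ) * ((G.δ v : ℤ) - 2)) := by
    have := h1.sub h3
    rwa [sub_sub_cancel] at this
  have h6 := Int.mul_ediv_cancel' h5.two_dvd
  unfold g0
  linarith

end ArithmeticalGraph

end RiemannRoch

/-! The core is that every divisor of degree at least `g₀` is equivalent to an effective one
(`exists_effective_of_g0_le_deg`). The quadratic form of `Q` is a weighted sum of squares of
differences of `x v / r v` over edges, hence positive semidefinite with kernel spanned by `R`. An
integral quadratic function with a positive multiple of it as leading part and linear part
orthogonal to `R` is therefore bounded below and attains its minimum on integral vectors. For a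
suitable linear part, minimality at `x` against each `x - e_v` says exactly that `D - Qx` is
effective.

If `g₀ ≤ 1`, every divisor of degree one is thus equivalent to an effective divisor of degree one,
which must be a single vertex of weight one. This determines `Σ(Λ)`: it consists of the divisors of
degree at most zero outside `Λ`. All ranks can then be computed. If `Λ = Λ_R`, then `g = 0` and `K =
-2w` for a vertex `w` of weight one; otherwise `g = 1` and `K = 0`
(`hasRiemannRochProperty_of_deg_one`).

The two special cases both have `g₀ = 1`. -/

namespace RiemannRoch

/-! ### Degrees, ranks and extreme divisors for a general lattice. -/

section Lattice

variable {V : Type*} [Fintype V] {R : V → ℕ} {Λ : Submodule ℤ (V → ℤ)}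

theorem deg_add (R : V → ℕ) (D E : V → ℤ) : deg R (D + E) = deg R D + deg R E := by
  simp [deg, mul_add, Finset.sum_add_distrib]

theorem deg_smul (R : V → ℕ) (c : ℤ) (D : V → ℤ) : deg R (c • D) = c * deg R D := by
  simp only [deg, Pi.smul_apply, smul_eq_mul, Finset.mul_sum]
  exact Finset.sum_congr rfl fun v _ => by ring

theorem deg_zero (R : V → ℕ) : deg R 0 = 0 := by simp [deg]

theorem deg_single [DecidableEq V] (R : V → ℕ) (v : V) : deg R (Pi.single v 1) = R v := by
  simp [deg, Pi.single_apply]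

theorem deg_eq_zero_of_mem (hΛ : Λ ≤ orthogonalLattice R) {D : V → ℤ} (hD : D ∈ Λ) :
    deg R D = 0 := hΛ hD

/-- For positive weights, an effective divisor that is not zero has positive degree. -/
theorem deg_pos (hR : ∀ v, 0 < R v) {E : V → ℤ} (hE : 0 ≤ E) (h0 : E ≠ 0) : 0 < deg R E := by
  obtain ⟨v, hv⟩ := Function.ne_iff.1 h0
  have hv' : 0 < E v := lt_of_le_of_ne (hE v) (Ne.symm hv)
  have h1 : (R v : ℤ) * E v ≤ deg R E :=
    Finset.single_le_sum (f := fun v => (R v : ℤ) * E v)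
      (fun v _ => mul_nonneg (Int.natCast_nonneg _) (hE v)) (Finset.mem_univ v)
  have h2 : 0 < (R v : ℤ) := by exact_mod_cast hR v
  exact (mul_pos h2 hv').trans_le h1

/-- An effective divisor of degree one is a vertex of weight one. -/
theorem exists_eq_single_of_deg_eq_one [DecidableEq V] (hR : ∀ v, 0 < R v) {E : V → ℤ}
    (hE : 0 ≤ E) (h1 : deg R E = 1) : ∃ v, R v = 1 ∧ E = Pi.single v 1 := by
  have h0 : E ≠ 0 := by
    rintro rfl
    simp [deg_zero] at h1
  obtain ⟨v, hv⟩ := Function.ne_iff.1 h0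
  have hv' : 0 < E v := lt_of_le_of_ne (hE v) (Ne.symm hv)
  have hle : 0 ≤ E - Pi.single v 1 := by
    intro u
    by_cases huv : u = v
    · subst huv
      simp only [Pi.zero_apply, Pi.sub_apply, Pi.single_eq_same]
      omega
    · simpa [huv] using hE u
  have hdeg := deg_sub R E (Pi.single v 1)
  rw [deg_single, h1] at hdeg
  have hRv := hR v
  have hnn := deg_nonneg R hle
  refine ⟨v, by omega, ?_⟩
  by_contra hne
  have := deg_pos hR hle (sub_ne_zero.2 hne)
  omega

theorem linearSystem_eq_empty_iff {V : Type*} {Λ : Submodule ℤ (V → ℤ)} {D : V → ℤ} :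
    linearSystem Λ D = ∅ ↔ D ∈ sigmaRegion Λ := by
  rw [Set.eq_empty_iff_forall_notMem]
  constructor
  · intro h p hp hle
    refine h (D - p) ⟨sub_nonneg.2 hle, ?_⟩
    rw [sub_sub_cancel_left]
    exact Λ.neg_mem hp
  · rintro h E ⟨hE, hED⟩
    refine h (D - E) ?_ (sub_le_self D hE)
    rw [← neg_sub]
    exact Λ.neg_mem hED

theorem rank_eq_of_isLeast {D : V → ℤ} {k : ℤ}
    (h : IsLeast (rankDegrees R Λ D) (k + 1)) : rank R Λ D = k := by
  rw [rank, h.csInf_eq, add_sub_cancel_right]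

theorem rank_eq_neg_one {D : V → ℤ} (hD : D ∈ sigmaRegion Λ) : rank R Λ D = -1 := by
  refine rank_eq_of_isLeast ⟨⟨0, le_rfl, ?_, by simp [deg_zero]⟩, ?_⟩
  · rwa [sub_zero, linearSystem_eq_empty_iff]
  · rintro d ⟨E, hE, -, rfl⟩
    simpa using deg_nonneg R hE

/-- If `c` bounds the degrees on `Σ(Λ)` and the bound is attained by subtracting an effective divisor
from `D`, then `r(D) = deg D - c - 1`. -/
theorem rank_eq_of_deg_le {c : ℤ} (hc : ∀ p ∈ sigmaRegion Λ, deg R p ≤ c) {D E : V → ℤ}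
    (hE : 0 ≤ E) (hDE : D - E ∈ sigmaRegion Λ) (hdeg : deg R E = deg R D - c) :
    rank R Λ D = deg R D - c - 1 := by
  refine rank_eq_of_isLeast ⟨⟨E, hE, linearSystem_eq_empty_iff.2 hDE, by rw [hdeg]; ring⟩, ?_⟩
  rintro d ⟨F, -, hF, rfl⟩
  have h1 := hc _ (linearSystem_eq_empty_iff.1 hF)
  rw [deg_sub] at h1
  linarith

/-- If every point of `Σ(Λ)` of degree less than the maximum `c` can be raised inside `Σ(Λ)`, then all
extreme divisors have degree `c`. -/
theorem image_deg_extremeDivisors [DecidableEq V] (hR : ∀ v, 0 < R v) {c : ℤ}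
    (hc : ∀ p ∈ sigmaRegion Λ, deg R p ≤ c) (hex : ∃ p ∈ sigmaRegion Λ, deg R p = c)
    (hraise : ∀ p ∈ sigmaRegion Λ, deg R p < c → ∃ v, p + Pi.single v 1 ∈ sigmaRegion Λ) :
    deg R '' extremeDivisors R Λ = {c} := by
  ext d
  constructor
  · rintro ⟨ν, ⟨hν, hmax⟩, rfl⟩
    by_contra hne
    obtain ⟨v, hv⟩ := hraise ν hν (lt_of_le_of_ne (hc ν hν) hne)
    have hdist : ∑ u, |(ν + Pi.single v 1 : V → ℤ) u - ν u| ≤ 1 := by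
      simp only [Pi.add_apply, add_sub_cancel_left, Pi.single_apply, apply_ite abs, abs_one,
        abs_zero]
      simp
    have h1 := hmax _ hv hdist
    rw [deg_add, deg_single] at h1
    have := hR v
    omega
  · rintro rfl
    obtain ⟨p, hp, hpd⟩ := hex
    exact ⟨p, ⟨hp, fun q hq _ => hpd ▸ hc q hq⟩, hpd⟩

/-! ### Lattices modulo which degree-one divisors are vertices. -/

section WeightOne

variable [DecidableEq V]

/-- If every divisor of degree one is equivalent to a vertex of weight one, then a divisor is equivalent
to no effective divisor exactly if its degree is at most zero and it is not in `Λ`. -/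
theorem mem_sigmaRegion_iff (hR : ∀ v, 0 < R v) (hΛ : Λ ≤ orthogonalLattice R)
    (h : ∀ D, deg R D = 1 → ∃ v, R v = 1 ∧ D - Pi.single v 1 ∈ Λ) {w : V} (hw : R w = 1)
    {D : V → ℤ} : D ∈ sigmaRegion Λ ↔ deg R D ≤ 0 ∧ D ∉ Λ := by
  constructor
  · intro hD
    refine ⟨?_, fun hmem => hD D hmem le_rfl⟩
    by_contra! hpos
    -- Removing `deg D - 1 ≥ 0` copies of `w` leaves degree one. Removing the vertex `v` as well
    -- lands in `Λ`, at a point below `D`.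
    obtain ⟨v, -, hv⟩ := h (D - (deg R D - 1) • Pi.single w 1) (by
      rw [deg_sub, deg_smul, deg_single, hw]; push_cast; ring)
    refine hD _ hv ?_
    rw [sub_sub]
    refine sub_le_self _ (add_nonneg (smul_nonneg (by omega) ?_) ?_) <;>
    exact Pi.single_nonneg.2 zero_le_one
  · rintro ⟨hdeg, hD⟩ p hp hle
    have h1 : deg R (D - p) = deg R D := by
      rw [deg_sub, deg_eq_zero_of_mem hΛ hp, sub_zero]
    by_cases h0 : D - p = 0
    · exact hD (sub_eq_zero.1 h0 ▸ hp)
    · have := deg_pos hR (sub_nonneg.2 hle) h0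
      omega

/-- The Riemann–Roch property for a full sublattice modulo which every divisor of degree one is
equivalent to a vertex of weight one. -/
theorem hasRiemannRochProperty_of_deg_one (hR : ∀ v, 0 < R v) (hΛ : IsFullSublattice R Λ)
    (h : ∀ D, deg R D = 1 → ∃ v, R v = 1 ∧ D - Pi.single v 1 ∈ Λ) {w : V} (hw : R w = 1) :
    HasRiemannRochProperty R Λ := by
  have hsig : ∀ {D : V → ℤ}, D ∈ sigmaRegion Λ ↔ deg R D ≤ 0 ∧ D ∉ Λ :=
    fun {D} => mem_sigmaRegion_iff hR hΛ.1 h hw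
  have hdeg1 : ∀ v, R v = 1 → deg R (Pi.single v 1) = 1 := fun v hv => by
    rw [deg_single, hv]; rfl
  have hneg : ∀ {D : V → ℤ}, deg R D < 0 → D ∈ sigmaRegion Λ := fun {D} hD =>
    hsig.2 ⟨hD.le, fun hmem => hD.ne (deg_eq_zero_of_mem hΛ.1 hmem)⟩
  have hs0 : ∀ v, (0 : V → ℤ) ≤ Pi.single v 1 := fun v => Pi.single_nonneg.2 zero_le_one
  refine ⟨hΛ, ?_⟩
  by_cases hall : orthogonalLattice R ≤ Λ
  · have hc : ∀ p ∈ sigmaRegion Λ, deg R p ≤ -1 := fun p hp => by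
      obtain ⟨h1, h2⟩ := hsig.1 hp
      have : deg R p ≠ 0 := fun h0 => h2 (hall h0)
      omega
    have himg : deg R '' extremeDivisors R Λ = {-1} := by
      refine image_deg_extremeDivisors hR hc ⟨(-1 : ℤ) • Pi.single w 1, hneg ?_, ?_⟩ ?_
      · rw [deg_smul, hdeg1 w hw]; norm_num
      · rw [deg_smul, hdeg1 w hw]; norm_num
      · refine fun p _ hp => ⟨w, hneg ?_⟩
        rw [deg_add, hdeg1 w hw]
        omega
    -- Remove `deg D + 1` copies of `w` to reach the maximal degree `-1` on `Σ(Λ)`. As `deg K = -2`,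
    -- one of `D` and `K - D` always has degree at least `-1` and the other has negative degree.
    have hrank : ∀ D, -1 ≤ deg R D → rank R Λ D = deg R D := fun D hD => by
      have := rank_eq_of_deg_le hc (D := D) (E := (deg R D + 1) • Pi.single w 1)
        (smul_nonneg (by omega) (hs0 w)) (hneg (by
          rw [deg_sub, deg_smul, hdeg1 w hw]; linarith)) (by
          rw [deg_smul, hdeg1 w hw]; ring)
      linarith
    refine ⟨0, ?_, ?_, (-2 : ℤ) • Pi.single w 1, ?_, fun D => ?_⟩
    · rw [IsGMin, himg]; exact isLeast_singleton
    · rw [IsGMax, himg]; exact isGreatest_singleton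
    · rw [deg_smul, hdeg1 w hw]; norm_num
    · have hK : deg R ((-2 : ℤ) • Pi.single w 1 - D) = -2 - deg R D := by
        rw [deg_sub, deg_smul, hdeg1 w hw]; ring
      rcases le_or_gt (-1) (deg R D) with hD | hD
      · rw [hrank D hD, rank_eq_neg_one (hneg (by omega))]
        ring
      · rw [rank_eq_neg_one (hneg (by omega)), hrank _ (by omega), hK]
        ring
  · obtain ⟨D₀, hD₀, hD₀Λ⟩ := SetLike.not_le_iff_exists.1 hall
    replace hD₀ : deg R D₀ = 0 := hD₀
    -- A degree-zero class outside `Λ` yields two inequivalent vertices `u`, `w` of weight one. No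
    -- divisor is equivalent to both, which allows `Λ` to be avoided below.
    obtain ⟨u, hu, huD⟩ := h (D₀ + Pi.single w 1) (by rw [deg_add, hdeg1 w hw, hD₀, zero_add])
    have huw : (Pi.single u 1 - Pi.single w 1 : V → ℤ) ∉ Λ := fun hmem => hD₀Λ (by
      have := Λ.add_mem huD hmem
      rwa [sub_add_sub_cancel, add_sub_cancel_right] at this)
    have hpick : ∀ D, deg R D = 1 →
        ∃ v, R v = 1 ∧ D - Pi.single v 1 ∈ sigmaRegion Λ := fun D hD => by
      by_contra! hcon
      have hmem : ∀ v, R v = 1 → D - Pi.single v 1 ∈ Λ := fun v hv => by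
        by_contra hnm
        refine hcon v hv (hsig.2 ⟨?_, hnm⟩)
        rw [deg_sub, hdeg1 v hv, hD, sub_self]
      refine huw ?_
      have := Λ.sub_mem (hmem w hw) (hmem u hu)
      rwa [sub_sub_sub_cancel_left] at this
    have hc : ∀ p ∈ sigmaRegion Λ, deg R p ≤ 0 := fun p hp => (hsig.1 hp).1
    have himg : deg R '' extremeDivisors R Λ = {0} := by
      refine image_deg_extremeDivisors hR hc ⟨D₀, hsig.2 ⟨hD₀.le, hD₀Λ⟩, hD₀⟩ fun p _ hp => ?_
      -- Only degree `-1` is delicate: the raised divisor has degree zero and must stay outside `Λ`.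
      -- If both `p + u` and `p + w` were in `Λ`, then `u` and `w` would be equivalent.
      by_cases hp1 : deg R p = -1
      · by_contra! hcon
        refine huw ?_
        have hmem : ∀ v, R v = 1 → p + Pi.single v 1 ∈ Λ := fun v hv => by
          by_contra hnm
          refine hcon v (hsig.2 ⟨?_, hnm⟩)
          rw [deg_add, hdeg1 v hv, hp1]
          norm_num
        have := Λ.sub_mem (hmem u hu) (hmem w hw)
        rwa [add_sub_add_left_eq_sub] at this
      · refine ⟨w, hneg ?_⟩
        rw [deg_add, hdeg1 w hw]
        omega
    have hrank : ∀ D, 1 ≤ deg R D → rank R Λ D = deg R D - 1 := fun D hD => by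
      obtain ⟨v, hv, hvD⟩ := hpick (D - (deg R D - 1) • Pi.single w 1) (by
        rw [deg_sub, deg_smul, hdeg1 w hw]; ring)
      have := rank_eq_of_deg_le hc (D := D) (E := (deg R D - 1) • Pi.single w 1 + Pi.single v 1)
        (add_nonneg (smul_nonneg (by omega) (hs0 w)) (hs0 v)) (by rwa [← sub_sub]) (by
          rw [deg_add, deg_smul, hdeg1 w hw, hdeg1 v hv]; ring)
      linarith
    have hrank0 : ∀ D ∈ Λ, rank R Λ D = 0 := fun D hD => by
      have hdD := deg_eq_zero_of_mem hΛ.1 hD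
      refine rank_eq_of_isLeast ⟨⟨Pi.single w 1, hs0 w, ?_, ?_⟩, ?_⟩
      · rw [linearSystem_eq_empty_iff]
        refine hneg ?_
        rw [deg_sub, hdeg1 w hw, hdD]
        norm_num
      · rw [hdeg1 w hw, zero_add]
      · rintro d ⟨E, hE, hempty, rfl⟩
        have hE0 : E ≠ 0 := by
          rintro rfl
          rw [sub_zero, linearSystem_eq_empty_iff] at hempty
          exact (hsig.1 hempty).2 hD
        have := deg_pos hR hE hE0
        omega
    refine ⟨1, ?_, ?_, 0, ?_, fun D => ?_⟩
    · rw [IsGMin, himg]; exact isLeast_singleton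
    · rw [IsGMax, himg]; exact isGreatest_singleton
    · rw [deg_zero]; norm_num
    · have hK : deg R (0 - D) = - deg R D := by
        rw [deg_sub, deg_zero]; ring
      rcases lt_trichotomy (deg R D) 0 with hD | hD | hD
      · rw [rank_eq_neg_one (hneg hD), hrank _ (by omega), hK]
        ring
      · by_cases hm : D ∈ Λ
        · rw [hrank0 D hm, hrank0 _ (Λ.sub_mem Λ.zero_mem hm), hD]
          ring
        · rw [rank_eq_neg_one (hsig.2 ⟨hD.le, hm⟩), rank_eq_neg_one (hsig.2 ⟨by omega, fun h' => hm ?_⟩), hD]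
          · ring
          · rwa [zero_sub, neg_mem_iff] at h'
      · rw [hrank D hD, rank_eq_neg_one (hneg (by omega))]
        ring

end WeightOne

end Lattice

/-! ### The Laplacian over the rationals and the rank of its lattice. -/

namespace ArithmeticalGraph

variable {V : Type*} [Fintype V] [DecidableEq V] (G : ArithmeticalGraph V)

theorem laplacian_mulVec_apply (x : V → ℤ) (v : V) :
    (G.laplacian.mulVec x) v = G.δ v * x v - ∑ u, (G.mult v u : ℤ) * x u := by
  rw [laplacian, Matrix.sub_mulVec, Pi.sub_apply, Matrix.mulVec_diagonal]
  simp [Matrix.mulVec, dotProduct, Multigraph.adjMatrix]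

theorem mem_lattice_iff {D : V → ℤ} : D ∈ G.lattice ↔ ∃ x, G.laplacian.mulVec x = D := by
  rw [lattice, ← Matrix.range_mulVecLin]
  rfl

/-- The Laplacian as an endomorphism of the rational vector space on the vertices. -/
def ratLaplacian : (V → ℚ) →ₗ[ℚ] (V → ℚ) := (G.laplacian.map (Int.cast : ℤ → ℚ)).mulVecLin

theorem ratLaplacian_apply (x : V → ℚ) (v : V) :
    G.ratLaplacian x v = G.δ v * x v - ∑ u, (G.mult v u : ℚ) * x u := by
  have h : G.laplacian.map (Int.cast : ℤ → ℚ)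
      = Matrix.diagonal (fun v => (G.δ v : ℚ)) - Matrix.of fun v u => (G.mult v u : ℚ) := by
    ext u v
    by_cases huv : u = v
    · subst huv
      simp [laplacian, Multigraph.adjMatrix]
    · simp [laplacian, Multigraph.adjMatrix, huv]
  rw [ratLaplacian, Matrix.mulVecLin_apply, h, Matrix.sub_mulVec, Pi.sub_apply,
    Matrix.mulVec_diagonal]
  simp [Matrix.mulVec, dotProduct]

theorem ratLaplacian_intCast (x : V → ℤ) (v : V) :
    G.ratLaplacian (fun u => (x u : ℚ)) v = (G.laplacian.mulVec x v : ℤ) := by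
  rw [ratLaplacian_apply, laplacian_mulVec_apply]
  push_cast
  rfl

theorem sum_mul_ratLaplacian_comm (x y : V → ℚ) :
    ∑ v, x v * G.ratLaplacian y v = ∑ v, y v * G.ratLaplacian x v := by
  simp only [ratLaplacian_apply, mul_sub, Finset.sum_sub_distrib, Finset.mul_sum]
  congr 1
  · exact Finset.sum_congr rfl fun v _ => by ring
  · rw [Finset.sum_comm]
    exact Finset.sum_congr rfl fun v _ => Finset.sum_congr rfl fun u _ => by
      rw [G.symm u v]; ring

theorem ratLaplacian_r : G.ratLaplacian (fun v => (G.r v : ℚ)) = 0 := by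
  ext v
  rw [ratLaplacian_apply, Pi.zero_apply, sub_eq_zero]
  exact_mod_cast G.delta_mul_r v

/-- The quadratic form of the Laplacian as a sum of squares over the edges. -/
theorem two_mul_sum_mul_ratLaplacian (x : V → ℚ) :
    2 * ∑ v, x v * G.ratLaplacian x v =
      ∑ v, ∑ u, (G.mult v u : ℚ) * G.r v * G.r u * (x v / G.r v - x u / G.r u) ^ 2 := by
  have hr : ∀ v, (G.r v : ℚ) ≠ 0 := fun v => by exact_mod_cast (G.r_pos v).ne'
  have hδ : ∀ v, (G.δ v : ℚ) * G.r v = ∑ u, (G.mult v u : ℚ) * G.r u := fun v => by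
    exact_mod_cast G.delta_mul_r v
  have h1 : ∀ v u, (G.mult v u : ℚ) * G.r v * G.r u * (x v / G.r v - x u / G.r u) ^ 2
      = (G.mult v u * G.r u) * (x v ^ 2 / G.r v) + (G.mult v u * G.r v) * (x u ^ 2 / G.r u)
        - 2 * (x v * (G.mult v u * x u)) := fun v u => by
    have := hr v
    have := hr u
    field_simp
    ring
  have h2 : ∑ v, ∑ u, (G.mult v u * G.r u : ℚ) * (x v ^ 2 / G.r v) = ∑ v, G.δ v * x v ^ 2 :=
    Finset.sum_congr rfl fun v _ => by
      rw [← Finset.sum_mul, ← hδ]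
      have := hr v
      field_simp
  have h3 : ∑ v, ∑ u, (G.mult v u * G.r v : ℚ) * (x u ^ 2 / G.r u) = ∑ v, G.δ v * x v ^ 2 := by
    rw [← h2, Finset.sum_comm]
    exact Finset.sum_congr rfl fun v _ => Finset.sum_congr rfl fun u _ => by rw [G.symm u v]
  simp only [h1, Finset.sum_sub_distrib, Finset.sum_add_distrib, h2, h3, ratLaplacian_apply,
    mul_sub, ← Finset.mul_sum]
  have h4 : ∑ v, x v * (G.δ v * x v) = ∑ v, (G.δ v : ℚ) * x v ^ 2 :=
    Finset.sum_congr rfl fun v _ => by ring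
  rw [h4]
  ring

theorem sum_mul_ratLaplacian_nonneg (x : V → ℚ) : 0 ≤ ∑ v, x v * G.ratLaplacian x v := by
  have h : 0 ≤ 2 * ∑ v, x v * G.ratLaplacian x v := by
    rw [two_mul_sum_mul_ratLaplacian]
    positivity
  linarith

/-- A vector in the kernel of the Laplacian is proportional to the multiplicities. -/
theorem mul_r_eq_of_ratLaplacian_eq_zero {x : V → ℚ} (hx : G.ratLaplacian x = 0) (u v : V) :
    x u * G.r v = x v * G.r u := by
  have hr : ∀ v, (G.r v : ℚ) ≠ 0 := fun v => by exact_mod_cast (G.r_pos v).ne'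
  have h0 := G.two_mul_sum_mul_ratLaplacian x
  simp only [hx, Pi.zero_apply, mul_zero, Finset.sum_const_zero] at h0
  -- The sum of squares vanishes, so each term does, and `x / r` agrees across every edge.
  -- Connectedness then makes it constant.
  have hadj : ∀ a b, G.toSimpleGraph.Adj a b → x a / G.r a = x b / G.r b := fun a b hab => by
    have h1 := (Finset.sum_eq_zero_iff_of_nonneg fun v _ =>
      Finset.sum_nonneg fun u _ => by positivity).1 h0.symm a (Finset.mem_univ a)
    have h2 := (Finset.sum_eq_zero_iff_of_nonneg fun u _ => by positivity).1 h1 b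
      (Finset.mem_univ b)
    have hm : (G.mult a b : ℚ) ≠ 0 := by exact_mod_cast hab
    have h3 : (x a / G.r a - x b / G.r b) ^ 2 = 0 := by
      simpa [hm, hr a, hr b] using h2
    exact sub_eq_zero.1 (pow_eq_zero_iff two_ne_zero |>.1 h3)
  have hwalk : ∀ a b, G.toSimpleGraph.Walk a b → x a / G.r a = x b / G.r b := fun a b p => by
    induction p with
    | nil => rfl
    | cons hab _ ih => exact (hadj _ _ hab).trans ih
  obtain ⟨p⟩ := G.connected.preconnected u v
  have := hwalk u v p
  rwa [div_eq_div_iff (hr u) (hr v)] at this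

theorem nonempty {V : Type*} [Fintype V] [DecidableEq V] (G : ArithmeticalGraph V) :
    Nonempty V := G.connected.nonempty

/-- A submodule that contains the multiplicity vector and all of whose members are proportional to it
has rank one. -/
theorem finrank_eq_one_of_proportional {𝕜 : Type*} [CommRing 𝕜] [IsDomain 𝕜] [CharZero 𝕜]
    [IsNoetherianRing 𝕜] (K : Submodule 𝕜 (V → 𝕜)) (hmem : (fun v => (G.r v : 𝕜)) ∈ K)
    (hK : ∀ x ∈ K, ∀ u v, x u * G.r v = x v * G.r u) : Module.finrank 𝕜 K = 1 := by
  obtain ⟨w⟩ := G.nonempty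
  have hr : ∀ v, (G.r v : 𝕜) ≠ 0 := fun v => by exact_mod_cast (G.r_pos v).ne'
  apply le_antisymm
  · have hinj : Function.Injective ((LinearMap.proj w : (V → 𝕜) →ₗ[𝕜] 𝕜) ∘ₗ K.subtype) := by
      rw [← LinearMap.ker_eq_bot, LinearMap.ker_eq_bot']
      rintro ⟨x, hx⟩ h0
      ext v
      have h1 := hK x hx v w
      have h2 : x w = 0 := h0
      rw [h2, zero_mul] at h1
      exact (mul_eq_zero.1 h1).resolve_right (hr w)
    simpa using LinearMap.finrank_le_finrank_of_injective hinj
  · have : Nontrivial K := ⟨⟨_, hmem⟩, 0, fun h =>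
      hr w (congrFun (congrArg Subtype.val h) w)⟩
    exact Module.finrank_pos

/-- The image of the rational Laplacian is the orthogonal complement of the multiplicity vector. -/
theorem exists_ratLaplacian_eq {b : V → ℚ} (hb : ∑ v, (G.r v : ℚ) * b v = 0) :
    ∃ y, G.ratLaplacian y = b := by
  obtain ⟨w⟩ := G.nonempty
  let φ : (V → ℚ) →ₗ[ℚ] ℚ := ∑ v, (G.r v : ℚ) • LinearMap.proj v
  have hφ : ∀ x, φ x = ∑ v, (G.r v : ℚ) * x v := fun x => by simp [φ]
  have hle : LinearMap.range G.ratLaplacian ≤ LinearMap.ker φ := by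
    rintro _ ⟨y, rfl⟩
    rw [LinearMap.mem_ker, hφ, sum_mul_ratLaplacian_comm G (fun v => (G.r v : ℚ)), ratLaplacian_r]
    simp
  have hsurj : LinearMap.range φ = ⊤ := by
    refine LinearMap.range_eq_top.2 (LinearMap.surjective fun h => ?_)
    have h1 : φ (Pi.single w 1) = 0 := by rw [h]; rfl
    rw [hφ] at h1
    have : G.r w = 0 := by simpa [Pi.single_apply] using h1
    exact (G.r_pos w).ne' this
  have h1 := LinearMap.finrank_range_add_finrank_ker φ
  have h2 := LinearMap.finrank_range_add_finrank_ker G.ratLaplacian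
  have h3 := G.finrank_eq_one_of_proportional (LinearMap.ker G.ratLaplacian) G.ratLaplacian_r
    fun x hx => G.mul_r_eq_of_ratLaplacian_eq_zero hx
  rw [hsurj, finrank_top, Module.finrank_self] at h1
  -- The kernel of the Laplacian and the range of `φ` are both one-dimensional, so the two spaces
  -- have equal dimension.
  have heq := Submodule.eq_of_le_of_finrank_eq hle (by omega)
  have hmem : b ∈ LinearMap.ker φ := by rw [LinearMap.mem_ker, hφ, hb]
  rw [← heq] at hmem
  exact hmem

/-- Symmetry of `Q` and `QR = 0` make its image orthogonal to `R`. The rank is rank-nullity over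
`ℤ`, with the integral kernel controlled by the rational one. -/
theorem isFullSublattice : IsFullSublattice G.r G.lattice := by
  constructor
  · intro D hD
    obtain ⟨x, rfl⟩ := G.mem_lattice_iff.1 hD
    have h := G.sum_mul_ratLaplacian_comm (fun v => (G.r v : ℚ)) (fun v => (x v : ℚ))
    simp only [ratLaplacian_r, ratLaplacian_intCast, Pi.zero_apply, mul_zero,
      Finset.sum_const_zero] at h
    have h' : deg G.r (G.laplacian.mulVec x) = 0 := by
      rw [deg]
      exact_mod_cast h
    exact h'
  · have h1 := (LinearMap.ker G.laplacian.mulVecLin).finrank_quotient_add_finrank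
    rw [G.laplacian.mulVecLin.quotKerEquivRange.finrank_eq] at h1
    rw [Matrix.range_mulVecLin, Module.finrank_fintype_fun_eq_card] at h1
    rw [← h1, lattice]
    congr 1
    refine (G.finrank_eq_one_of_proportional (LinearMap.ker G.laplacian.mulVecLin) ?_ ?_).symm
    · exact G.mulVec_r
    · intro x hx u v
      have hx' : G.laplacian.mulVec x = 0 := hx
      have h2 := G.mul_r_eq_of_ratLaplacian_eq_zero (x := fun v => (x v : ℚ)) (by
        ext v
        rw [ratLaplacian_intCast, hx']
        simp) u v
      exact_mod_cast h2

/-! ### Minimizing a quadratic function to find effective divisors. -/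

/-- A quadratic function with the Laplacian as quadratic part and with linear part orthogonal to the
multiplicities attains its minimum on the integral vectors. -/
theorem exists_minimizer {T : ℤ} (hT : 0 < T) {b : V → ℤ} (hb : deg G.r b = 0) :
    ∃ x : V → ℤ, ∀ z : V → ℤ,
      T * (x ⬝ᵥ G.laplacian.mulVec x) - x ⬝ᵥ b ≤ T * (z ⬝ᵥ G.laplacian.mulVec z) - z ⬝ᵥ b := by
  have hT' : (0 : ℚ) < T := by exact_mod_cast hT
  -- Completing the square: since `2TQy = b`, the function at `z` equals `T (z - y)ᵀQ(z - y) - C`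
  -- with `C = T yᵀQy`, so it is at least `-C`.
  obtain ⟨y, hy⟩ := G.exists_ratLaplacian_eq (b := fun v => (b v : ℚ) / (2 * T)) (by
    have h : ∑ v, (G.r v : ℚ) * b v = 0 := by
      rw [deg] at hb
      exact_mod_cast hb
    simp only [← mul_div_assoc, ← Finset.sum_div, h, zero_div])
  set C : ℚ := T * ∑ v, y v * G.ratLaplacian y v with hC
  have hlow : ∀ z : V → ℤ, -C ≤ ((T * (z ⬝ᵥ G.laplacian.mulVec z) - z ⬝ᵥ b : ℤ) : ℚ) := fun z => by
    have h1 := G.sum_mul_ratLaplacian_nonneg ((fun v => (z v : ℚ)) - y)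
    have h2 := G.sum_mul_ratLaplacian_comm y (fun v => (z v : ℚ))
    have h3 : ∑ v, (z v : ℚ) * G.ratLaplacian y v = (∑ v, (z v : ℚ) * b v) / (2 * T) := by
      rw [hy, Finset.sum_div]
      exact Finset.sum_congr rfl fun v _ => by ring
    simp only [map_sub, Pi.sub_apply, sub_mul, mul_sub, Finset.sum_sub_distrib] at h1
    rw [h2, h3] at h1
    have h4 : ((z ⬝ᵥ G.laplacian.mulVec z : ℤ) : ℚ)
        = ∑ v, (z v : ℚ) * G.ratLaplacian (fun v => (z v : ℚ)) v := by
      simp only [ratLaplacian_intCast, dotProduct]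
      push_cast
      rfl
    have h5 : ((z ⬝ᵥ b : ℤ) : ℚ) = ∑ v, (z v : ℚ) * b v := by
      simp only [dotProduct]
      push_cast
      rfl
    push_cast
    rw [h4, h5, hC]
    have h6 := mul_nonneg hT'.le h1
    have h7 : (T : ℚ) * ((∑ v, (z v : ℚ) * b v) / (2 * T)) = (∑ v, (z v : ℚ) * b v) / 2 := by
      field_simp
    linarith [h6, h7]
  -- The values are integers bounded below, so the infimum is attained even though the form is
  -- degenerate along `R`.
  obtain ⟨m, ⟨x, hx⟩, hm⟩ := Int.exists_least_of_bdd
    (P := fun k => ∃ x : V → ℤ, T * (x ⬝ᵥ G.laplacian.mulVec x) - x ⬝ᵥ b = k)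
    ⟨⌊-C⌋, by
      rintro k ⟨z, rfl⟩
      have := (Int.floor_le (-C)).trans (hlow z)
      exact_mod_cast this⟩ ⟨_, 0, rfl⟩
  exact ⟨x, fun z => hx ▸ hm _ ⟨z, rfl⟩⟩

theorem isSymm_laplacian : G.laplacian.IsSymm := by
  ext u v
  by_cases huv : u = v
  · subst huv; rfl
  · simp [laplacian, Multigraph.adjMatrix, huv, Ne.symm huv, G.symm u v]

/-- The change of the quadratic form of the Laplacian when a vertex is subtracted. -/
theorem dotProduct_laplacian_sub_single (x : V → ℤ) (v : V) :
    (x - Pi.single v 1) ⬝ᵥ G.laplacian.mulVec (x - Pi.single v 1)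
      = x ⬝ᵥ G.laplacian.mulVec x - 2 * G.laplacian.mulVec x v + G.δ v := by
  have h1 : x ⬝ᵥ G.laplacian.mulVec (Pi.single v 1) = G.laplacian.mulVec x v := by
    rw [Matrix.dotProduct_mulVec, ← Matrix.mulVec_transpose, G.isSymm_laplacian.eq,
      dotProduct_single, mul_one]
  have h2 : G.laplacian.mulVec (Pi.single v 1) v = G.δ v := by
    simp [laplacian_mulVec_apply, Pi.single_apply, G.loopless]
  rw [Matrix.mulVec_sub, dotProduct_sub, sub_dotProduct, sub_dotProduct, h1, single_dotProduct,
    single_dotProduct, h2]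
  ring

/-- Every divisor of degree at least `g₀` is equivalent to an effective divisor. -/
theorem exists_effective_of_g0_le_deg {D : V → ℤ} (hD : G.g0 ≤ deg G.r D) :
    ∃ E, 0 ≤ E ∧ D - E ∈ G.lattice := by
  have := G.nonempty
  set T : ℤ := ∑ v, (G.r v : ℤ) with hTdef
  have hT : 0 < T := Finset.sum_pos (fun v _ => by exact_mod_cast G.r_pos v) Finset.univ_nonempty
  -- This `m` makes `b` below orthogonal to `R`, because `deg b = 2T deg D - T(2g₀ - 2) - 2mT`. The
  -- degree hypothesis says `m ≥ 1`.
  set m : ℤ := deg G.r D - G.g0 + 1 with hm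
  have hg := G.two_mul_g0_sub_two
  obtain ⟨x, hx⟩ := G.exists_minimizer hT
    (b := fun v => 2 * T * D v - T * (G.δ v - 2) - 2 * m) (by
      have h1 : ∀ v, (G.r v : ℤ) * (2 * T * D v - T * (G.δ v - 2) - 2 * m)
          = 2 * T * (G.r v * D v) - T * (G.r v * (G.δ v - 2)) - 2 * m * G.r v := fun v => by ring
      simp only [deg, h1, Finset.sum_sub_distrib, ← Finset.mul_sum]
      rw [← hg, ← hTdef, hm, deg]
      ring)
  refine ⟨D - G.laplacian.mulVec x, fun v => ?_, G.mem_lattice_iff.2 ⟨x, (sub_sub_cancel _ _).symm⟩⟩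
  -- Minimality gives `T(δ_v - 2(Qx)_v) + b_v ≥ 0`, that is, `T((D - Qx)_v + 1) ≥ m > 0`. An integer
  -- coordinate exceeding `-1` is non-negative.
  have h2 := hx (x - Pi.single v 1)
  rw [dotProduct_laplacian_sub_single, sub_dotProduct, single_dotProduct] at h2
  by_contra hneg
  replace hneg : ¬ (0 : ℤ) ≤ D v - G.laplacian.mulVec x v := hneg
  have hle : D v - G.laplacian.mulVec x v ≤ -1 := by omega
  have h3 := mul_le_mul_of_nonneg_left hle hT.le
  linarith

/-! ### Conclusion for `g₀ ≤ 1` and the special cases. -/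

/-- Bézout for the multiplicities, whose gcd is one. Together with the equivalence of degree-one
divisors to vertices, this supplies a vertex of weight one. -/
theorem exists_deg_eq_one : ∃ D : V → ℤ, deg G.r D = 1 := by
  let I : Ideal ℤ := Ideal.span (Set.range fun v => (G.r v : ℤ))
  let a := Submodule.IsPrincipal.generator I
  have ha : ∀ v, a.natAbs ∣ G.r v := fun v => by
    rw [← Int.natAbs_natCast (G.r v), Int.natAbs_dvd_natAbs]
    exact (Submodule.IsPrincipal.mem_iff_generator_dvd I).1
      (Ideal.subset_span (Set.mem_range_self v))
  have h1 : a ∣ 1 := by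
    have h2 : a.natAbs ∣ 1 := G.gcd_r ▸ Finset.dvd_gcd fun v _ => ha v
    exact Int.natAbs_dvd_natAbs.1 h2
  have h3 : (1 : ℤ) ∈ I := (Submodule.IsPrincipal.mem_iff_generator_dvd I).2 h1
  obtain ⟨D, hD⟩ := (Submodule.mem_span_range_iff_exists_fun ℤ).1 h3
  refine ⟨D, ?_⟩
  rw [← hD, deg]
  exact Finset.sum_congr rfl fun v _ => mul_comm _ _

theorem hasRiemannRochProperty_of_g0_le_one (hg : G.g0 ≤ 1) :
    HasRiemannRochProperty G.r G.lattice := by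
  have h : ∀ D, deg G.r D = 1 → ∃ v, G.r v = 1 ∧ D - Pi.single v 1 ∈ G.lattice := fun D hD => by
    obtain ⟨E, hE, hDE⟩ := G.exists_effective_of_g0_le_deg (hg.trans_eq hD.symm)
    have h1 := deg_eq_zero_of_mem G.isFullSublattice.1 hDE
    rw [deg_sub] at h1
    obtain ⟨v, hv, rfl⟩ := exists_eq_single_of_deg_eq_one G.r_pos hE (by omega)
    exact ⟨v, hv, hDE⟩
  obtain ⟨D, hD⟩ := G.exists_deg_eq_one
  obtain ⟨w, hw, -⟩ := h D hD
  exact hasRiemannRochProperty_of_deg_one G.r_pos G.isFullSublattice h hw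

theorem g0_eq_one_of_sum_eq (h : ∑ v, (G.r v : ℤ) * G.δ v = ∑ v, (G.r v : ℤ) * 2) : G.g0 = 1 := by
  have h1 := G.two_mul_g0_sub_two
  simp only [mul_sub, Finset.sum_sub_distrib, h, sub_self] at h1
  omega

/-- Sum `δ_v r_v = ∑ mult(v,u) r_u` over `v` and exchange the sums. Hence `g₀` does not change when
`δ` is replaced by the vertex degrees in its definition. -/
theorem sum_r_mul_delta : ∑ v, (G.r v : ℤ) * G.δ v = ∑ v, (G.r v : ℤ) * G.degree v := by
  have h1 : ∀ v, (G.r v : ℤ) * G.δ v = ∑ u, (G.mult v u : ℤ) * G.r u := fun v => by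
    rw [mul_comm, delta_mul_r]
  simp only [h1, Multigraph.degree]
  rw [Finset.sum_comm]
  refine Finset.sum_congr rfl fun v _ => ?_
  push_cast
  rw [Finset.mul_sum]
  exact Finset.sum_congr rfl fun u _ => by rw [G.symm u v, mul_comm]

end ArithmeticalGraph

end RiemannRoch

theorem mainTheorem12 {V : Type*} [Fintype V] [DecidableEq V]
    (G : RiemannRoch.ArithmeticalGraph V) :
    (G.g0 ≤ 1 → RiemannRoch.HasRiemannRochProperty G.r G.lattice) ∧
    ((∀ v, G.δ v = 2) → RiemannRoch.HasRiemannRochProperty G.r G.lattice) ∧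
    ((∀ v, G.degree v = 2) → RiemannRoch.HasRiemannRochProperty G.r G.lattice) := by
  refine ⟨G.hasRiemannRochProperty_of_g0_le_one, fun h => ?_, fun h => ?_⟩
  · refine G.hasRiemannRochProperty_of_g0_le_one (G.g0_eq_one_of_sum_eq ?_).le
    simp [h]
  · refine G.hasRiemannRochProperty_of_g0_le_one (G.g0_eq_one_of_sum_eq ?_).le
    rw [G.sum_r_mul_delta]
    simp [h]
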